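/- All digraphs are finite, without loops and without multiple arcs (opposite arcs $(u,v)$ and $(v,u)$ may both be present); all undirected graphs are finite and simple. For two vertex-disjoint digraphs $G_1=(V_1,E_1)$, $G_2=(V_2,E_2)$, the disjoint union $G_1\oplus G_2$ has vertex set $V_1\cup V_2$ and arc set $E_1\cup E_2$, and the order composition $G_1\oslash G_2$ has vertex set $V_1\cup V_2$ and arc set $E_1\cup E_2\cup\{(u,v)\mid u\in V_1, v\in V_2\}$. The class of \emph{oriented weakly quasi threshold graphs} is defined recursively: every edgeless digraph belongs to it; if $G_1$ and $G_2$ belong to it, then so does $G_1\oplus G_2$; if $G$ belongs to it and $I$ is an edgeless digraph, then $G\oslash I$ and $I\oslash G$ belong to it. The class of (undirected) \emph{weakly quasi threshold graphs} is defined recursively: every edgeless graph belongs to it; if $G_1$ and $G_2$ belong to it, then so does their disjoint union; if $G$ belongs to it and $I$ is an edgeless graph, then the join of $G$ and $I$ (the disjoint union together with all edges between $G$ and $I$) belongs to it. Both classes are closed under isomorphism. A digraph is \emph{transitive} if for all arcs $(u,v)$ and $(v,w)$ with $u\neq w$ the pair $(u,w)$ is also an arc. The underlying undirected graph $\mathrm{un}(G)$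 has the same vertices as $G$, and $u,v$ are adjacent in it iff $(u,v)$ or $(v,u)$ is an arc of $G$. For a set $F$ of digraphs, $\mathrm{Free}(F)$ is the class of digraphs none of whose induced subdigraphs is isomorphic to a member of $F$. Let - $D_1$ be the oriented path with vertices $a,b,c$ and arcs $(a,b),(b,c)$; - $D_5$ be the oriented 3-cycle with arcs $(a,b),(b,c),(c,a)$; - $D_8$ be the digraph on $a,b,c,d$ with arcs $(a,b),(c,b),(c,d)$; - $\overleftrightarrow{K_2}$ be the digraph on $a,b$ with arcs $(a,b),(b,a)$; - $Q_7=Y_4\oslash Y_4$, where $Y_4$ is the digraph on $a,b,c$ with the single arc $(a,b)$. \textbf{Theorem.} Let $G$ be a digraph. The following properties are equivalent: 1. $G$ is an oriented weakly quasi threshold graph. 2. $G\in\mathrm{Free}(\{D_1,D_5,D_8,\overleftrightarrow{K_2},Q_7\})$. 3. $G\in\mathrm{Free}(\{D_8,\overleftrightarrow{K_2},Q_7\})$ and $G$ is transitive. 4. $G\in\mathrm{Free}(\{D_1,D_5,\overleftrightarrow{K_2}\})$ and $\mathrm{un}(G)$ is a weakly quasi threshold graph. -/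

import Mathlib

/-! Digraphs are represented by `Digraph V` with a finite vertex type and no loops (the latter is
the predicate `IsLoopless`). An isomorphism of digraphs is a relation isomorphism. -/

universe u

namespace Digraph

/-- No vertex has an arc to itself. -/
def IsLoopless {V : Type*} (G : Digraph V) : Prop :=
  ∀ v, ¬ G.Adj v v

/-- A digraph is transitive if for all arcs `(u,v)` and `(v,w)` with `u ≠ w` the pair `(u,w)` is
an arc as well. -/
def IsTransitive {V : Type*} (G : Digraph V) : Prop :=
  ∀ u v w, G.Adj u v → G.Adj v w → u ≠ w → G.Adj u w

/-- The subdigraph of `G` induced by the vertex set `s`. -/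
def induced {V : Type*} (G : Digraph V) (s : Set V) : Digraph s where
  Adj u v := G.Adj u v

/-- The class `Free(F)`: no induced subdigraph of `G` is isomorphic to a member of `F`. -/
def Free (F : Set (Σ W : Type, Digraph W)) {V : Type*} (G : Digraph V) : Prop :=
  ∀ s : Set V, ∀ H ∈ F, IsEmpty ((G.induced s).Adj ≃r H.2.Adj)

/-- The disjoint union `G₁ ⊕ G₂`. -/
def disjUnion {V W : Type*} (G : Digraph V) (H : Digraph W) : Digraph (V ⊕ W) where
  Adj
    | Sum.inl u, Sum.inl v => G.Adj u v
    | Sum.inr u, Sum.inr v => H.Adj u v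
    | _, _ => False

/-- The order composition `G₁ ⊘ G₂`: all arcs from the vertices of `G₁` to those of `G₂` are added
to the disjoint union. -/
def orderComp {V W : Type*} (G : Digraph V) (H : Digraph W) : Digraph (V ⊕ W) where
  Adj
    | Sum.inl u, Sum.inl v => G.Adj u v
    | Sum.inr u, Sum.inr v => H.Adj u v
    | Sum.inl _, Sum.inr _ => True
    | Sum.inr _, Sum.inl _ => False

/-- Oriented weakly quasi threshold graphs. The edgeless digraph on `V` is `⊥`. Since vertex sets
are types, the disjoint union of vertex sets is the sum type, and the class is closed under
isomorphism. -/
inductive IsOWQT : ∀ {V : Type u}, Digraph V → Prop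
  | edgeless (V : Type u) [Finite V] : IsOWQT (⊥ : Digraph V)
  | disjUnion {V W : Type u} {G : Digraph V} {H : Digraph W} :
      IsOWQT G → IsOWQT H → IsOWQT (G.disjUnion H)
  | orderComp_edgeless {V : Type u} {G : Digraph V} (I : Type u) [Finite I] :
      IsOWQT G → IsOWQT (G.orderComp (⊥ : Digraph I))
  | edgeless_orderComp {V : Type u} {G : Digraph V} (I : Type u) [Finite I] :
      IsOWQT G → IsOWQT ((⊥ : Digraph I).orderComp G)
  | iso {V W : Type u} {G : Digraph V} {H : Digraph W} :
      IsOWQT G → (G.Adj ≃r H.Adj) → IsOWQT H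

/-- The digraph on `{0, …, n-1}` whose arcs are the pairs in `l`. -/
def ofArcs (n : ℕ) (l : List (Fin n × Fin n)) : Digraph (Fin n) where
  Adj u v := (u, v) ∈ l

/-- `D₁`: the oriented path on three vertices. -/
def D1 : Digraph (Fin 3) := ofArcs 3 [(0, 1), (1, 2)]

/-- `D₅`: the oriented cycle on three vertices. -/
def D5 : Digraph (Fin 3) := ofArcs 3 [(0, 1), (1, 2), (2, 0)]

/-- `D₈`: the transitive orientation of the path `0 - 1 - 2 - 3`. -/
def D8 : Digraph (Fin 4) := ofArcs 4 [(0, 1), (2, 1), (2, 3)]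

/-- The bidirectional complete digraph on two vertices. -/
def biK2 : Digraph (Fin 2) := ofArcs 2 [(0, 1), (1, 0)]

/-- `Y₄`: one arc and one isolated vertex. -/
def Y4 : Digraph (Fin 3) := ofArcs 3 [(0, 1)]

/-- `Q₇ = Y₄ ⊘ Y₄`. -/
def Q7 : Digraph (Fin 3 ⊕ Fin 3) := Y4.orderComp Y4

end Digraph

namespace SimpleGraph

/-- The join `G₁ ⊗ G₂`: all edges between the two graphs are added to the disjoint union. -/
def joinGraph {V W : Type*} (G : SimpleGraph V) (H : SimpleGraph W) : SimpleGraph (V ⊕ W) :=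
  (G ⊕g H) ⊔ completeBipartiteGraph V W

/-- Weakly quasi threshold graphs. -/
inductive IsWQT : ∀ {V : Type u}, SimpleGraph V → Prop
  | edgeless (V : Type u) [Finite V] : IsWQT (⊥ : SimpleGraph V)
  | disjUnion {V W : Type u} {G : SimpleGraph V} {H : SimpleGraph W} :
      IsWQT G → IsWQT H → IsWQT (G ⊕g H)
  | join_edgeless {V : Type u} {G : SimpleGraph V} (I : Type u) [Finite I] :
      IsWQT G → IsWQT (G.joinGraph (⊥ : SimpleGraph I))
  | iso {V W : Type u} {G : SimpleGraph V} {H : SimpleGraph W} :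
      IsWQT G → (G ≃g H) → IsWQT H

end SimpleGraph

namespace Digraph

variable {V W : Type*}

/-! Excluding opposite arcs makes the digraph oriented; excluding `D1` and `D5` as well is then the
same as transitivity. A weakly quasi threshold graph has no induced P₄ and no induced complement of
2P₃, which are the underlying graphs of `D8` and `Q7`; so structural induction on both recursive
classes gives 1 → 4 → 3.

The substance is the decomposition behind 2 → 1, by induction on the number of vertices. A
disconnected digraph splits as a disjoint union. In a connected one, the absence of P₄ bounds
distances by 2, and transitivity then yields an arc from every source to every sink. If neither the
sources nor the sinks could be split off by an order composition, the two failures would together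
produce an induced `Q7`. -/

@[simp] lemma disjUnion_inl_inl (G : Digraph V) (H : Digraph W) (u v : V) :
    (G.disjUnion H).Adj (.inl u) (.inl v) ↔ G.Adj u v := Iff.rfl

@[simp] lemma disjUnion_inr_inr (G : Digraph V) (H : Digraph W) (u v : W) :
    (G.disjUnion H).Adj (.inr u) (.inr v) ↔ H.Adj u v := Iff.rfl

@[simp] lemma disjUnion_inl_inr (G : Digraph V) (H : Digraph W) (u : V) (v : W) :
    (G.disjUnion H).Adj (.inl u) (.inr v) ↔ False := Iff.rfl

@[simp] lemma disjUnion_inr_inl (G : Digraph V) (H : Digraph W) (u : W) (v : V) :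
    (G.disjUnion H).Adj (.inr u) (.inl v) ↔ False := Iff.rfl

@[simp] lemma orderComp_inl_inl (G : Digraph V) (H : Digraph W) (u v : V) :
    (G.orderComp H).Adj (.inl u) (.inl v) ↔ G.Adj u v := Iff.rfl

@[simp] lemma orderComp_inr_inr (G : Digraph V) (H : Digraph W) (u v : W) :
    (G.orderComp H).Adj (.inr u) (.inr v) ↔ H.Adj u v := Iff.rfl

@[simp] lemma orderComp_inl_inr (G : Digraph V) (H : Digraph W) (u : V) (v : W) :
    (G.orderComp H).Adj (.inl u) (.inr v) ↔ True := Iff.rfl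

@[simp] lemma orderComp_inr_inl (G : Digraph V) (H : Digraph W) (u : W) (v : V) :
    (G.orderComp H).Adj (.inr u) (.inl v) ↔ False := Iff.rfl

@[simp] lemma induced_adj (G : Digraph V) (s : Set V) (u v : s) :
    (G.induced s).Adj u v ↔ G.Adj u v := Iff.rfl

/-- `G` is `F`-free iff no member of `F` embeds into `G`. -/
theorem free_iff {F : Set (Σ W : Type, Digraph W)} {G : Digraph V} :
    G.Free F ↔ ∀ H ∈ F, IsEmpty (H.2.Adj ↪r G.Adj) := by
  constructor
  · refine fun h H hH => ⟨fun e => (h (Set.range e) H hH).false ?_⟩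
    exact RelIso.symm
      { toEquiv := Equiv.ofInjective e e.injective
        map_rel_iff' := e.map_rel_iff }
  · refine fun h s H hH => ⟨fun e => (h H hH).false ?_⟩
    exact e.symm.toRelEmbedding.trans
      { toEmbedding := Function.Embedding.subtype _
        map_rel_iff' := Iff.rfl }

theorem Free.isEmpty {F : Set (Σ W : Type, Digraph W)} {G : Digraph V} (h : G.Free F)
    {U : Type} {H : Digraph U} (hH : (⟨U, H⟩ : Σ W : Type, Digraph W) ∈ F) :
    IsEmpty (H.Adj ↪r G.Adj) :=
  free_iff.1 h _ hH

/-- No two vertices are joined by arcs in both directions. -/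
def IsOriented (G : Digraph V) : Prop :=
  ∀ u v, G.Adj u v → ¬ G.Adj v u

/-- Adjacency in the underlying undirected graph. -/
def Linked (G : Digraph V) (u v : V) : Prop :=
  G.Adj u v ∨ G.Adj v u

/-- There is no induced copy of `D₈`. -/
def NFree (G : Digraph V) : Prop :=
  ∀ a b c d, G.Adj a b → G.Adj c b → G.Adj c d →
    G.Linked a c ∨ G.Linked b d ∨ G.Linked a d

/-- The vertices `a, b, c` induce a copy of `Y₄`. -/
def IsY4 (G : Digraph V) (a b c : V) : Prop :=
  G.Adj a b ∧ ¬ G.Linked a c ∧ ¬ G.Linked b c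

/-- There is no induced copy of `Q₇`. -/
def Q7Free (G : Digraph V) : Prop :=
  ∀ a b c a' b' c', G.IsY4 a b c → G.IsY4 a' b' c' →
    ¬ ((G.Adj a a' ∧ G.Adj a b' ∧ G.Adj a c') ∧ (G.Adj b a' ∧ G.Adj b b' ∧ G.Adj b c') ∧
      (G.Adj c a' ∧ G.Adj c b' ∧ G.Adj c c'))

/-! ### Forbidden subdigraphs as conditions on arcs -/

lemma isEmpty_biK2_iff {G : Digraph V} (hG : G.IsLoopless) :
    IsEmpty (biK2.Adj ↪r G.Adj) ↔ G.IsOriented := by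
  constructor
  · refine fun h u v huv hvu => h.false ⟨⟨![u, v], ?_⟩, ?_⟩
    · have : u ≠ v := by rintro rfl; exact hG _ huv
      intro i j
      fin_cases i <;> fin_cases j <;> simp [this, this.symm]
    · intro i j
      have hu := hG u
      have hv := hG v
      change G.Adj (![u, v] i) (![u, v] j) ↔ _
      fin_cases i <;> fin_cases j <;> simp [biK2, ofArcs, *]
  · refine fun h => ⟨fun e => h (e 0) (e 1) (e.map_rel_iff.2 ?_) (e.map_rel_iff.2 ?_)⟩ <;>
      simp [biK2, ofArcs]

lemma IsOriented.isLoopless {G : Digraph V} (h : G.IsOriented) : G.IsLoopless :=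
  fun v hv => h v v hv hv

/-- An oriented digraph without induced `D₁` and `D₅` is transitive. -/
lemma isTransitive_of_isEmpty {G : Digraph V} (hG : G.IsOriented)
    (h1 : IsEmpty (D1.Adj ↪r G.Adj)) (h5 : IsEmpty (D5.Adj ↪r G.Adj)) : G.IsTransitive := by
  intro u v w huv hvw hne
  by_contra huw
  have h1' : u ≠ v := by rintro rfl; exact hG _ _ huv huv
  have h2' : v ≠ w := by rintro rfl; exact hG _ _ hvw hvw
  have hinj : Function.Injective ![u, v, w] := by
    intro i j
    fin_cases i <;> fin_cases j <;> simp [h1', h2', hne, h1'.symm, h2'.symm, hne.symm]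
  have hu := hG.isLoopless u
  have hv := hG.isLoopless v
  have hw := hG.isLoopless w
  have hvu := hG _ _ huv
  have hwv := hG _ _ hvw
  -- The arc closing the path decides between an induced `D5` and an induced `D1`.
  by_cases hwu : G.Adj w u
  · refine h5.false ⟨⟨_, hinj⟩, ?_⟩
    intro i j
    change G.Adj (![u, v, w] i) (![u, v, w] j) ↔ _
    fin_cases i <;> fin_cases j <;> simp [D5, ofArcs, *]
  · refine h1.false ⟨⟨_, hinj⟩, ?_⟩
    intro i j
    change G.Adj (![u, v, w] i) (![u, v, w] j) ↔ _
    fin_cases i <;> fin_cases j <;> simp [D1, ofArcs, *]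

lemma IsTransitive.isEmpty_D1 {G : Digraph V} (hG : G.IsTransitive) :
    IsEmpty (D1.Adj ↪r G.Adj) := by
  refine ⟨fun e => ?_⟩
  have := hG (e 0) (e 1) (e 2) (e.map_rel_iff.2 (by simp [D1, ofArcs]))
    (e.map_rel_iff.2 (by simp [D1, ofArcs])) (e.injective.ne (by decide))
  rw [e.map_rel_iff] at this
  simp [D1, ofArcs] at this

lemma IsTransitive.isEmpty_D5 {G : Digraph V} (hG : G.IsTransitive) :
    IsEmpty (D5.Adj ↪r G.Adj) := by
  refine ⟨fun e => ?_⟩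
  have := hG (e 0) (e 1) (e 2) (e.map_rel_iff.2 (by simp [D5, ofArcs]))
    (e.map_rel_iff.2 (by simp [D5, ofArcs])) (e.injective.ne (by decide))
  rw [e.map_rel_iff] at this
  simp [D5, ofArcs] at this

/-- `NFree` need not ask for distinct vertices: the required arcs and non-arcs already force them
apart. -/
lemma isEmpty_D8_iff {G : Digraph V} (hG : G.IsOriented) :
    IsEmpty (D8.Adj ↪r G.Adj) ↔ G.NFree := by
  constructor
  · intro h a b c d hab hcb hcd
    by_contra hcon
    simp only [Linked, not_or] at hcon
    obtain ⟨⟨hac, hca⟩, ⟨hbd, hdb⟩, had, hda⟩ := hcon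
    have hba := hG _ _ hab
    have hbc := hG _ _ hcb
    have hdc := hG _ _ hcd
    have ha := hG.isLoopless a
    have hb := hG.isLoopless b
    have hc := hG.isLoopless c
    have hd := hG.isLoopless d
    refine h.false ⟨⟨![a, b, c, d], ?_⟩, ?_⟩
    · have h1 : a ≠ b := by rintro rfl; contradiction
      have h2 : a ≠ c := by rintro rfl; contradiction
      have h3 : a ≠ d := by rintro rfl; contradiction
      have h4 : b ≠ c := by rintro rfl; contradiction
      have h5 : b ≠ d := by rintro rfl; contradiction
      have h6 : c ≠ d := by rintro rfl; contradiction
      intro i j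
      fin_cases i <;> fin_cases j <;>
        simp [h1, h2, h3, h4, h5, h6, h1.symm, h2.symm, h3.symm, h4.symm, h5.symm, h6.symm]
    · intro i j
      change G.Adj (![a, b, c, d] i) (![a, b, c, d] j) ↔ _
      fin_cases i <;> fin_cases j <;> simp [D8, ofArcs, *]
  · refine fun h => ⟨fun e => ?_⟩
    have := h (e 0) (e 1) (e 2) (e 3) (e.map_rel_iff.2 (by simp [D8, ofArcs]))
      (e.map_rel_iff.2 (by simp [D8, ofArcs])) (e.map_rel_iff.2 (by simp [D8, ofArcs]))
    simp only [Linked, e.map_rel_iff] at this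
    simp [D8, ofArcs] at this

/-- A copy of `Y₄` in an oriented digraph gives an embedding of `Y₄`. -/
lemma IsY4.exists_embedding {G : Digraph V} (hG : G.IsOriented) {a b c : V} (h : G.IsY4 a b c) :
    ∃ e : Y4.Adj ↪r G.Adj, (e : Fin 3 → V) = ![a, b, c] := by
  obtain ⟨hab, hac, hbc⟩ := h
  simp only [Linked, not_or] at hac hbc
  obtain ⟨hac, hca⟩ := hac
  obtain ⟨hbc, hcb⟩ := hbc
  have hba := hG _ _ hab
  have ha := hG.isLoopless a
  have hb := hG.isLoopless b
  have hc := hG.isLoopless c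
  refine ⟨⟨⟨![a, b, c], ?_⟩, ?_⟩, rfl⟩
  · have h1 : a ≠ b := by rintro rfl; contradiction
    have h2 : a ≠ c := by rintro rfl; contradiction
    have h3 : b ≠ c := by rintro rfl; contradiction
    intro i j
    fin_cases i <;> fin_cases j <;> simp [h1, h2, h3, h1.symm, h2.symm, h3.symm]
  · intro i j
    change G.Adj (![a, b, c] i) (![a, b, c] j) ↔ _
    fin_cases i <;> fin_cases j <;> simp [Y4, ofArcs, *]

/-- Two embeddings with all arcs from the first image to the second give an embedding of the order
composition. -/
lemma nonempty_orderComp_embedding {U U' : Type*} {G : Digraph V} (hG : G.IsOriented)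
    {H : Digraph U} {K : Digraph U'} (e : H.Adj ↪r G.Adj) (f : K.Adj ↪r G.Adj)
    (h : ∀ i j, G.Adj (e i) (f j)) : Nonempty ((H.orderComp K).Adj ↪r G.Adj) := by
  refine ⟨⟨⟨Sum.elim e f, ?_⟩, ?_⟩⟩
  · refine e.injective.sumElim f.injective fun i j hij => hG.isLoopless (f j) ?_
    have := h i j
    rwa [hij] at this
  · rintro (i | i) (j | j)
    · exact e.map_rel_iff
    · simpa using h i j
    · simpa using hG _ _ (h j i)
    · exact f.map_rel_iff

lemma isEmpty_Q7_iff {G : Digraph V} (hG : G.IsOriented) :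
    IsEmpty (Q7.Adj ↪r G.Adj) ↔ G.Q7Free := by
  constructor
  · rintro h a b c a' b' c' hY hY' ⟨⟨h1, h2, h3⟩, ⟨h4, h5, h6⟩, h7, h8, h9⟩
    obtain ⟨e, he⟩ := hY.exists_embedding hG
    obtain ⟨f, hf⟩ := hY'.exists_embedding hG
    refine (not_nonempty_iff.2 h) (nonempty_orderComp_embedding hG e f ?_)
    intro i j
    rw [he, hf]
    fin_cases i <;> fin_cases j <;> simp [*]
  · refine fun h => ⟨fun e => ?_⟩
    refine h (e (.inl 0)) (e (.inl 1)) (e (.inl 2)) (e (.inr 0)) (e (.inr 1)) (e (.inr 2)) ?_ ?_ ?_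
    all_goals
      simp only [IsY4, Linked, e.map_rel_iff]
      simp [Q7, Y4, ofArcs]

/-! ### Properties of oriented weakly quasi threshold graphs -/

section

universe v

variable {X Y : Type v}

theorem IsOWQT.isOriented {G : Digraph X} (h : G.IsOWQT) : G.IsOriented := by
  induction h with
  | edgeless V => exact fun _ _ h => h.elim
  | disjUnion _ _ ih ih' =>
    rintro (u | u) (v | v) <;> simp <;> first | exact ih u v | exact ih' u v
  | orderComp_edgeless I _ ih =>
    rintro (u | u) (v | v) <;> simp
    exact ih u v
  | edgeless_orderComp I _ ih =>
    rintro (u | u) (v | v) <;> simp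
    exact ih u v
  | iso _ e ih =>
    intro u v huv hvu
    exact ih _ _ (e.symm.map_rel_iff.2 huv) (e.symm.map_rel_iff.2 hvu)

theorem IsOWQT.isTransitive {G : Digraph X} (h : G.IsOWQT) : G.IsTransitive := by
  induction h with
  | edgeless V => exact fun _ _ _ h => h.elim
  | disjUnion _ _ ih ih' =>
    rintro (u | u) (v | v) (w | w) <;> simp <;> first | exact ih u v w | exact ih' u v w
  | orderComp_edgeless I _ ih =>
    rintro (u | u) (v | v) (w | w) <;> simp
    exact ih u v w
  | edgeless_orderComp I _ ih =>
    rintro (u | u) (v | v) (w | w) <;> simp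
    exact ih u v w
  | iso _ e ih =>
    intro u v w huv hvw hne
    exact e.symm.map_rel_iff.1
      (ih _ _ _ (e.symm.map_rel_iff.2 huv) (e.symm.map_rel_iff.2 hvw) (e.symm.injective.ne hne))

lemma toSimpleGraphInclusive_adj (G : Digraph V) (u v : V) :
    G.toSimpleGraphInclusive.Adj u v ↔ u ≠ v ∧ G.Linked u v := by
  simp [toSimpleGraphInclusive, Linked]

/-- Isomorphic digraphs have isomorphic underlying graphs. -/
def toSimpleGraphInclusiveIso {G : Digraph V} {H : Digraph W} (e : G.Adj ≃r H.Adj) :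
    G.toSimpleGraphInclusive ≃g H.toSimpleGraphInclusive where
  toEquiv := e.toEquiv
  map_rel_iff' := by
    intro u v
    simp [toSimpleGraphInclusive_adj, Linked, e.map_rel_iff]

theorem IsOWQT.isWQT {G : Digraph X} (h : G.IsOWQT) : G.toSimpleGraphInclusive.IsWQT := by
  induction h with
  | edgeless V =>
    convert SimpleGraph.IsWQT.edgeless V
    simp
  | disjUnion _ _ ih ih' =>
    convert ih.disjUnion ih'
    ext u v
    rcases u with u | u <;> rcases v with v | v <;> simp [toSimpleGraphInclusive_adj, Linked]
  | orderComp_edgeless I _ ih =>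
    convert ih.join_edgeless I
    ext u v
    rcases u with u | u <;> rcases v with v | v <;>
      simp [toSimpleGraphInclusive_adj, Linked, SimpleGraph.joinGraph]
  | edgeless_orderComp I _ ih =>
    refine (ih.join_edgeless I).iso ⟨Equiv.sumComm _ _, ?_⟩
    intro u v
    rcases u with u | u <;> rcases v with v | v <;>
      simp [toSimpleGraphInclusive_adj, Linked, SimpleGraph.joinGraph]
  | iso _ e ih => exact ih.iso (toSimpleGraphInclusiveIso e)

end

end Digraph

/-! ### Induced subgraphs excluded from weakly quasi threshold graphs -/

namespace SimpleGraph

universe v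

variable {X : Type v}

/-- Weakly quasi threshold graphs contain no induced path on four vertices. -/
theorem IsWQT.P4_free {G : SimpleGraph X} (h : G.IsWQT) (a b c d : X) (hab : G.Adj a b)
    (hbc : G.Adj b c) (hcd : G.Adj c d) : G.Adj a c ∨ G.Adj b d ∨ G.Adj a d := by
  induction h with
  | edgeless V => exact hab.elim
  | disjUnion _ _ ih ih' =>
    rcases a with a | a <;> rcases b with b | b <;> rcases c with c | c <;> rcases d with d | d <;>
      simp at hab hbc hcd ⊢
    · exact ih _ _ _ _ hab hbc hcd
    · exact ih' _ _ _ _ hab hbc hcd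
  -- P₄ has a connected complement, so it lies on one side of a join, and the edgeless side cannot
  -- hold it.
  | join_edgeless I _ ih =>
    rcases a with a | a <;> rcases b with b | b <;> rcases c with c | c <;> rcases d with d | d <;>
      simp [joinGraph] at hab hbc hcd ⊢
    exact ih _ _ _ _ hab hbc hcd
  | iso _ e ih =>
    have := ih (e.symm a) (e.symm b) (e.symm c) (e.symm d)
    simp only [e.symm.map_adj_iff] at this
    exact this hab hbc hcd

/-- The vertices `a, b, c` induce the disjoint union of an edge `ab` and a vertex `c`. -/
def IsCoP3 (G : SimpleGraph X) (a b c : X) : Prop :=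
  G.Adj a b ∧ ¬ G.Adj a c ∧ ¬ G.Adj b c

/-- Weakly quasi threshold graphs contain no induced complement of `2 P₃`. -/
theorem IsWQT.co2P3_free {G : SimpleGraph X} (h : G.IsWQT) (a b c a' b' c' : X)
    (hY : G.IsCoP3 a b c) (hY' : G.IsCoP3 a' b' c') :
    ¬ ((G.Adj a a' ∧ G.Adj a b' ∧ G.Adj a c') ∧ (G.Adj b a' ∧ G.Adj b b' ∧ G.Adj b c') ∧
      (G.Adj c a' ∧ G.Adj c b' ∧ G.Adj c c')) := by
  unfold IsCoP3 at hY hY'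
  induction h with
  | edgeless V => exact hY.1.elim
  | disjUnion _ _ ih ih' =>
    -- The cross edges connect all six vertices, so they lie in one summand.
    rintro ⟨⟨h1, h2, h3⟩, ⟨h4, h5, h6⟩, h7, h8, h9⟩
    rcases a with a | a <;> rcases a' with a' | a' <;> simp at h1 <;>
    rcases b with b | b <;> simp at h4 <;> rcases c with c | c <;> simp at h7 <;>
    rcases b' with b' | b' <;> simp at h2 <;> rcases c' with c' | c' <;> simp at h3
    · exact ih a b c a' b' c' (by simpa using hY) (by simpa using hY')
        (by simp at *; tauto)
    · exact ih' a b c a' b' c' (by simpa using hY) (by simpa using hY')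
        (by simp at *; tauto)
  | join_edgeless I _ ih =>
    rintro ⟨⟨h1, h2, h3⟩, ⟨h4, h5, h6⟩, h7, h8, h9⟩
    -- Each triple has a connected complement and contains an edge, so it avoids `I`.
    rcases a with a | a <;> rcases b with b | b <;> rcases c with c | c <;>
      simp [joinGraph] at hY <;>
    rcases a' with a' | a' <;> rcases b' with b' | b' <;> rcases c' with c' | c' <;>
      simp [joinGraph] at hY'
    exact ih a b c a' b' c' hY hY' (by simp [joinGraph] at *; tauto)
  | iso _ e ih =>
    have := ih (e.symm a) (e.symm b) (e.symm c) (e.symm a') (e.symm b') (e.symm c')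
    simp only [e.symm.map_adj_iff] at this
    exact this hY hY'

end SimpleGraph

/-! ### Transfer from the underlying graph -/

namespace Digraph

section

variable {V : Type*} {G : Digraph V}

lemma toSimpleGraphInclusive_adj_iff_linked (hG : G.IsLoopless) (u v : V) :
    G.toSimpleGraphInclusive.Adj u v ↔ G.Linked u v := by
  rw [toSimpleGraphInclusive_adj, and_iff_right_of_imp]
  rintro h rfl
  exact h.elim (hG _) (hG _)

lemma Linked.symm {u v : V} (h : G.Linked u v) : G.Linked v u := Or.symm h

lemma nFree_of_isWQT (hG : G.IsLoopless) (h : G.toSimpleGraphInclusive.IsWQT) : G.NFree := by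
  intro a b c d hab hcb hcd
  have := h.P4_free a b c d
  simp only [toSimpleGraphInclusive_adj_iff_linked hG] at this
  exact this (.inl hab) (.inr hcb) (.inl hcd)

lemma q7Free_of_isWQT (hG : G.IsLoopless) (h : G.toSimpleGraphInclusive.IsWQT) : G.Q7Free := by
  rintro a b c a' b' c' ⟨h1, h2⟩ ⟨h3, h4⟩ h5
  have := h.co2P3_free a b c a' b' c'
  simp only [SimpleGraph.IsCoP3, toSimpleGraphInclusive_adj_iff_linked hG] at this
  refine this ⟨.inl h1, h2⟩ ⟨.inl h3, h4⟩ ?_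
  simp only [Linked]
  tauto

/-! ### Decomposition of transitive oriented graphs -/

lemma IsTransitive.trans (ht : G.IsTransitive) (ho : G.IsOriented) {u v w : V}
    (huv : G.Adj u v) (hvw : G.Adj v w) : G.Adj u w :=
  ht u v w huv hvw (by rintro rfl; exact ho _ _ huv hvw)

/-- The underlying graph of a transitive oriented graph without induced `D₈` has no induced path
on four vertices. -/
lemma NFree.P4_free (hN : G.NFree) (ht : G.IsTransitive) (ho : G.IsOriented) {a b c d : V}
    (hab : G.Linked a b) (hbc : G.Linked b c) (hcd : G.Linked c d) :
    G.Linked a c ∨ G.Linked b d ∨ G.Linked a d := by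
  rcases hab with hab | hab <;> rcases hbc with hbc | hbc
  · exact .inl (.inl (ht.trans ho hab hbc))
  · rcases hcd with hcd | hcd
    · exact hN _ _ _ _ hab hbc hcd
    · exact .inr (.inl (.inr (ht.trans ho hcd hbc)))
  · rcases hcd with hcd | hcd
    · exact .inr (.inl (.inl (ht.trans ho hbc hcd)))
    · rcases hN _ _ _ _ hcd hbc hab with h | h | h
      · exact .inr (.inl h.symm)
      · exact .inl h.symm
      · exact .inr (.inr h.symm)
  · exact .inl (.inr (ht.trans ho hbc hab))

/-- No proper nonempty set of vertices is separated from its complement. -/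
def Connected (G : Digraph V) : Prop :=
  ∀ s : Set V, s.Nonempty → (∀ u ∈ s, ∀ v, G.Linked u v → v ∈ s) → s = Set.univ

/-- Without P₄, the set of vertices at distance at most 2 from `u` is closed under adjacency, hence
is everything. -/
lemma Connected.linked_or_exists (hc : G.Connected) (hN : G.NFree) (ht : G.IsTransitive)
    (ho : G.IsOriented) (u v : V) :
    u = v ∨ G.Linked u v ∨ ∃ z, G.Linked u z ∧ G.Linked z v := by
  have := hc {v | u = v ∨ G.Linked u v ∨ ∃ z, G.Linked u z ∧ G.Linked z v} ⟨u, .inl rfl⟩ ?_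
  · have hv := Set.mem_univ v
    rwa [← this] at hv
  · rintro w hw w' hww'
    rcases hw with rfl | hw | ⟨z, huz, hzw⟩
    · exact .inr (.inl hww')
    · exact .inr (.inr ⟨w, hw, hww'⟩)
    · rcases hN.P4_free ht ho huz hzw hww' with h | h | h
      · exact .inr (.inr ⟨w, h, hww'⟩)
      · exact .inr (.inr ⟨z, huz, h⟩)
      · exact .inr (.inl h)

/-- Vertices without incoming arcs. -/
def IsSource (G : Digraph V) (v : V) : Prop := ∀ u, ¬ G.Adj u v

/-- Vertices without outgoing arcs. -/
def IsSink (G : Digraph V) (v : V) : Prop := ∀ u, ¬ G.Adj v u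

lemma exists_isSource [Finite V] (ht : G.IsTransitive) (ho : G.IsOriented) {v : V}
    (hv : ¬ G.IsSource v) : ∃ u, G.IsSource u ∧ G.Adj u v := by
  have : Std.Irrefl G.Adj := ⟨ho.isLoopless⟩
  have : IsTrans V G.Adj := ⟨fun _ _ _ => ht.trans ho⟩
  have wf : WellFounded G.Adj := Finite.wellFounded_of_trans_of_irrefl _
  simp only [IsSource, not_forall, not_not] at hv
  -- By transitivity, a minimal in-neighbour of `v` is minimal in the whole digraph.
  obtain ⟨u, hu, hmin⟩ := wf.has_min {u | G.Adj u v} hv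
  exact ⟨u, fun w hw => hmin w (ht.trans ho hw hu) hw, hu⟩

/-- The digraph with all arcs reversed. -/
def reversed (G : Digraph V) : Digraph V where
  Adj u v := G.Adj v u

lemma exists_isSink [Finite V] (ht : G.IsTransitive) (ho : G.IsOriented) {v : V}
    (hv : ¬ G.IsSink v) : ∃ u, G.IsSink u ∧ G.Adj v u :=
  exists_isSource (G := G.reversed) (fun _ _ _ h h' hne => ht _ _ _ h' h hne.symm)
    (fun _ _ h h' => ho _ _ h h') hv

lemma Connected.adj_of_isSource_of_isSink (hc : G.Connected) (hN : G.NFree) (ht : G.IsTransitive)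
    (ho : G.IsOriented) {m s : V} (hm : G.IsSource m) (hs : G.IsSink s) (hne : m ≠ s) :
    G.Adj m s := by
  rcases hc.linked_or_exists hN ht ho m s with h | h | ⟨z, h, h'⟩
  · exact absurd h hne
  · exact h.resolve_right (hm _)
  · exact ht.trans ho (h.resolve_right (hm _)) (h'.resolve_right (hs _))

/-- In a connected transitive oriented graph without induced `D₈` and `Q₇` the sources or the sinks
can be split off by an order composition. -/
lemma Connected.sources_or_sinks [Finite V] (hc : G.Connected) (hN : G.NFree) (hQ : G.Q7Free)
    (ht : G.IsTransitive) (ho : G.IsOriented) :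
    (∀ m x, G.IsSource m → ¬ G.IsSource x → G.Adj m x) ∨
      (∀ s y, G.IsSink s → ¬ G.IsSink y → G.Adj y s) := by
  by_contra! ⟨⟨m, x, hm, hx, hmx⟩, s, y, hs, hy, hys⟩
  obtain ⟨p, hp, hpx⟩ := exists_isSource ht ho hx
  obtain ⟨r, hr, hyr⟩ := exists_isSink ht ho hy
  have source_ne_sink : ∀ {a b}, G.IsSource a → G.IsSink b → a ≠ b := by
    rintro a _ ha hb rfl
    -- A vertex that is both source and sink is isolated, so connectedness would leave no room for
    -- the arc `hpx`.
    have : ({a} : Set V) = Set.univ := by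
      refine hc _ ⟨a, rfl⟩ ?_
      rintro _ rfl v (h | h)
      · exact (hb _ h).elim
      · exact (ha _ h).elim
    have hpa : p ∈ ({a} : Set V) := this ▸ Set.mem_univ p
    have hxa : x ∈ ({a} : Set V) := this ▸ Set.mem_univ x
    rw [Set.mem_singleton_iff] at hpa hxa
    rw [hpa, hxa] at hpx
    exact ho.isLoopless _ hpx
  have key : ∀ {a b}, G.IsSource a → G.IsSink b → G.Adj a b := fun ha hb =>
    hc.adj_of_isSource_of_isSink hN ht ho ha hb (source_ne_sink ha hb)
  have hmp : ¬ G.Linked m p := fun h => h.elim (hp _) (hm _)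
  have hmx' : ¬ G.Linked m x := fun h => h.elim hmx (hm _)
  have hsr : ¬ G.Linked s r := fun h => h.elim (hs _) (hr _)
  have hsy : ¬ G.Linked s y := fun h => h.elim (hs _) hys
  have hxsink : ∀ {b}, G.IsSink b → G.Adj x b := by
    intro b hb
    -- The pattern m → b ← p → x would be an induced `D8` unless `x` and `b` are linked.
    rcases hN m b p x (key hm hb) (key hp hb) hpx with h | h | h
    · exact (hmp h).elim
    · exact h.resolve_left (hb _)
    · exact (hmx' h).elim
  have hysource : ∀ {a}, G.IsSource a → G.Adj a y := by
    intro a ha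
    rcases hN y r a s hyr (key ha hr) (key ha hs) with h | h | h
    · exact h.resolve_left (ha _)
    · exact (hsr h.symm).elim
    · exact (hsy h.symm).elim
  -- In x → s ← m → y only a link between `x` and `y` is possible; an arc from `y` to `x` would give
  -- the excluded arc from `y` to `s`.
  have hxy : G.Adj x y := by
    rcases hN x s m y (hxsink hs) (key hm hs) (hysource hm) with h | h | h
    · exact (hmx' h.symm).elim
    · exact (hsy h).elim
    · exact h.resolve_right fun h => hys (ht.trans ho h (hxsink hs))
  exact hQ p x m y r s ⟨hpx, fun h => hmp h.symm, fun h => hmx' h.symm⟩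
    ⟨hyr, fun h => hsy h.symm, fun h => hsr h.symm⟩
    ⟨⟨hysource hp, key hp hr, key hp hs⟩, ⟨hxy, hxsink hr, hxsink hs⟩,
      hysource hm, key hm hr, key hm hs⟩

/-- A digraph without arcs between `s` and its complement is a disjoint union. -/
lemma nonempty_iso_disjUnion (s : Set V) (h : ∀ u ∈ s, ∀ v ∉ s, ¬ G.Linked u v) :
    Nonempty (((G.induced s).disjUnion (G.induced sᶜ)).Adj ≃r G.Adj) := by
  classical
  refine ⟨⟨Equiv.Set.sumCompl s, ?_⟩⟩
  rintro (u | u) (v | v)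
  · simp
  · simpa using fun h' => h u u.2 v v.2 (.inl h')
  · simpa using fun h' => h v v.2 u u.2 (.inr h')
  · simp

/-- A digraph with all arcs from `s` to its complement is an order composition. -/
lemma nonempty_iso_orderComp (ho : G.IsOriented) (s : Set V)
    (h : ∀ u ∈ s, ∀ v ∉ s, G.Adj u v) :
    Nonempty (((G.induced s).orderComp (G.induced sᶜ)).Adj ≃r G.Adj) := by
  classical
  refine ⟨⟨Equiv.Set.sumCompl s, ?_⟩⟩
  rintro (u | u) (v | v)
  · simp
  · simpa using h u u.2 v v.2
  · simpa using ho _ _ (h v v.2 u u.2)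
  · simp

lemma eq_bot_of_forall_not_adj (h : ∀ u v, ¬ G.Adj u v) : G = ⊥ := by
  ext u v
  simp [h u v]

/-- Transitive oriented graphs without induced `D₈` and `Q₇` are oriented weakly quasi threshold
graphs. -/
theorem isOWQT_of_free [Finite V] (ho : G.IsOriented) (ht : G.IsTransitive) (hN : G.NFree)
    (hQ : G.Q7Free) : G.IsOWQT := by
  induction hn : Nat.card V using Nat.strong_induction_on generalizing V with
  | _ n ih =>
  subst hn
  have ih' : ∀ s : Set V, s ≠ Set.univ → (G.induced s).IsOWQT := by
    intro s hs
    refine ih _ ?_ (fun _ _ => ho _ _) (fun u v w h h' hne => ht _ _ _ h h' (Subtype.coe_injective.ne hne))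
      (fun a b c d => hN a b c d) (fun a b c a' b' c' => hQ a b c a' b' c') rfl
    rw [Nat.card_coe_set_eq, ← Set.ncard_univ V]
    exact Set.ncard_lt_ncard (Set.ssubset_univ_iff.2 hs)
  by_cases hE : ∀ u v, ¬ G.Adj u v
  · rw [eq_bot_of_forall_not_adj hE]
    exact .edgeless V
  push Not at hE
  obtain ⟨a, b, hab⟩ := hE
  by_cases hc : G.Connected
  · rcases hc.sources_or_sinks hN hQ ht ho with h | h
    · obtain ⟨e⟩ := nonempty_iso_orderComp ho {v | G.IsSource v} fun u hu v hv => h u v hu hv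
      rw [eq_bot_of_forall_not_adj (G := G.induced {v | G.IsSource v})
        fun u v huv => v.2 _ huv] at e
      -- The head `b` of an arc lies above some source, so the non-sources form a proper subset and
      -- the induction hypothesis applies.
      obtain ⟨c, hc⟩ := exists_isSource ht ho fun hb : G.IsSource b => hb a hab
      refine (IsOWQT.edgeless_orderComp _ (ih' _ fun hs => ?_)).iso e
      have hcs : c ∈ {v | G.IsSource v}ᶜ := hs ▸ Set.mem_univ c
      exact hcs hc.1
    · obtain ⟨e⟩ := nonempty_iso_orderComp ho {v | G.IsSink v}ᶜ
        fun u hu v hv => h v u (not_not.1 hv) hu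
      rw [eq_bot_of_forall_not_adj (G := G.induced {v | G.IsSink v}ᶜᶜ)
        fun u v huv => not_not.1 u.2 _ huv] at e
      obtain ⟨c, hc⟩ := exists_isSink ht ho fun ha : G.IsSink a => ha b hab
      refine (IsOWQT.orderComp_edgeless _ (ih' _ fun hs => ?_)).iso e
      have hcs : c ∈ {v | G.IsSink v}ᶜ := hs ▸ Set.mem_univ c
      exact hcs hc.1
  · simp only [Connected, not_forall] at hc
    obtain ⟨s, hne, hs, hs'⟩ := hc
    obtain ⟨e⟩ := nonempty_iso_disjUnion (G := G) s fun u hu v hv huv => hv (hs u hu v huv)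
    exact ((ih' s hs').disjUnion (ih' sᶜ (by simpa using hne.ne_empty))).iso e

end

end Digraph

theorem mainTheorem7 {V : Type*} [Finite V] (G : Digraph V) (hG : G.IsLoopless) :
    List.TFAE
      [ G.IsOWQT,
        G.Free {⟨_, Digraph.D1⟩, ⟨_, Digraph.D5⟩, ⟨_, Digraph.D8⟩, ⟨_, Digraph.biK2⟩,
          ⟨_, Digraph.Q7⟩},
        G.Free {⟨_, Digraph.D8⟩, ⟨_, Digraph.biK2⟩, ⟨_, Digraph.Q7⟩} ∧ G.IsTransitive,
        G.Free {⟨_, Digraph.D1⟩, ⟨_, Digraph.D5⟩, ⟨_, Digraph.biK2⟩} ∧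
          G.toSimpleGraphInclusive.IsWQT ] := by
  tfae_have 1 → 4 := by
    intro h
    refine ⟨Digraph.free_iff.2 ?_, h.isWQT⟩
    rintro _ (rfl | rfl | rfl)
    · exact h.isTransitive.isEmpty_D1
    · exact h.isTransitive.isEmpty_D5
    · exact (Digraph.isEmpty_biK2_iff hG).2 h.isOriented
  tfae_have 4 → 3 := by
    rintro ⟨h, hW⟩
    have ho := (Digraph.isEmpty_biK2_iff hG).1 (h.isEmpty (by simp))
    refine ⟨Digraph.free_iff.2 ?_,
      Digraph.isTransitive_of_isEmpty ho (h.isEmpty (by simp)) (h.isEmpty (by simp))⟩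
    rintro _ (rfl | rfl | rfl)
    · exact (Digraph.isEmpty_D8_iff ho).2 (Digraph.nFree_of_isWQT hG hW)
    · exact h.isEmpty (by simp)
    · exact (Digraph.isEmpty_Q7_iff ho).2 (Digraph.q7Free_of_isWQT hG hW)
  tfae_have 3 → 2 := by
    rintro ⟨h, ht⟩
    refine Digraph.free_iff.2 ?_
    rintro _ (rfl | rfl | rfl | rfl | rfl)
    · exact ht.isEmpty_D1
    · exact ht.isEmpty_D5
    all_goals exact h.isEmpty (by simp)
  tfae_have 2 → 1 := by
    intro h
    have ho := (Digraph.isEmpty_biK2_iff hG).1 (h.isEmpty (by simp))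
    exact Digraph.isOWQT_of_free ho
      (Digraph.isTransitive_of_isEmpty ho (h.isEmpty (by simp)) (h.isEmpty (by simp)))
      ((Digraph.isEmpty_D8_iff ho).1 (h.isEmpty (by simp)))
      ((Digraph.isEmpty_Q7_iff ho).1 (h.isEmpty (by simp)))
  tfae_finish
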